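/- Let $M$ be a smooth Riemannian manifold of dimension $m\ge 1$ (without boundary) with smooth metric $g=(g_{ij})$, and let $\Sigma\subset M$ be a smooth hypersurface, i.e. a smoothly embedded $(m-1)$-dimensional submanifold without boundary. Let $c\in\mathbb{R}$. Then every point $p\in\Sigma$ has an open neighbourhood $U\subset M$ on which there exists a smooth ($C^\infty$) function $f:U\to\mathbb{R}$ that satisfies the eikonal equation $$|\nabla f|^2=g^{ij}\frac{\partial f}{\partial x^i}\frac{\partial f}{\partial x^j}=1\quad\text{on } U$$ and the boundary condition $f(x)=c$ for all $x\in U\cap\Sigma$. Here $\nabla f$ is the Riemannian gradient of $f$, that is, $g(\nabla f,v)=df(v)$ for every tangent vector $v$. -/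

import Mathlib

open scoped Manifold ContDiff Bundle

noncomputable section

/-- A subset `S` of an `(n+1)`-dimensional smooth manifold `M` is a (smooth, embedded)
hypersurface: with the subspace topology it carries the structure of an `n`-dimensional smooth
manifold without boundary for which the inclusion `S → M` is a smooth embedding
(an immersion that is a homeomorphism onto its image). -/
def IsHypersurface (n : ℕ) {M : Type*} [TopologicalSpace M]
    [ChartedSpace (EuclideanSpace ℝ (Fin (n + 1))) M] (S : Set M) : Prop :=
  ∃ _ : ChartedSpace (EuclideanSpace ℝ (Fin n)) S,
    IsManifold (𝓡 n) ∞ S ∧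
      Manifold.IsSmoothEmbedding (𝓡 n) (𝓡 (n + 1)) ∞ (Subtype.val : S → M)

/-- The Riemannian gradient of `f` at `x`: the tangent vector that represents the differential
of `f` at `x` through the metric, i.e. `⟪∇f(x), v⟫ = df_x(v)` for all `v ∈ T_x M`. -/
def riemannianGradient (m : ℕ) {M : Type*} [TopologicalSpace M]
    [ChartedSpace (EuclideanSpace ℝ (Fin m)) M]
    [Bundle.RiemannianBundle (fun x : M ↦ TangentSpace (𝓡 m) x)]
    (f : M → ℝ) (x : M) : TangentSpace (𝓡 m) x :=
  haveI : FiniteDimensional ℝ (TangentSpace (𝓡 m) x) :=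
    inferInstanceAs (FiniteDimensional ℝ (EuclideanSpace ℝ (Fin m)))
  haveI : CompleteSpace (TangentSpace (𝓡 m) x) := FiniteDimensional.complete ℝ _
  (InnerProductSpace.toDual ℝ (TangentSpace (𝓡 m) x)).symm
    (mfderiv (𝓡 m) 𝓘(ℝ, ℝ) f x : TangentSpace (𝓡 m) x →L[ℝ] ℝ)

/-- The defining property of the gradient. -/
theorem inner_riemannianGradient {m : ℕ} {M : Type*} [TopologicalSpace M]
    [ChartedSpace (EuclideanSpace ℝ (Fin m)) M]
    [Bundle.RiemannianBundle (fun x : M ↦ TangentSpace (𝓡 m) x)]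
    (f : M → ℝ) (x : M) (v : TangentSpace (𝓡 m) x) :
    inner ℝ (riemannianGradient m f x) v = mfderiv (𝓡 m) 𝓘(ℝ, ℝ) f x v := by
  have : FiniteDimensional ℝ (TangentSpace (𝓡 m) x) :=
    inferInstanceAs (FiniteDimensional ℝ (EuclideanSpace ℝ (Fin m)))
  have : CompleteSpace (TangentSpace (𝓡 m) x) := FiniteDimensional.complete ℝ _
  exact InnerProductSpace.toDual_symm_apply

end

/-! The proof is the method of characteristics. In a chart carrying Σ near p into a hyperplane ker
ℓ, take the unit covectors proportional to ℓ along the hyperplane and move (x, p) by the Hamiltonian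
field of |p|²/2. The flow preserves |p|² = 1, and on that level the pullback of the tautological
form p dx is invariant in time (`exists_hasFDerivAt_tautologicalForm`). At time 0 this form vanishes
on vectors tangent to the hyperplane, so in the variables (time, foot on the hyperplane) it is dt.
Characteristics leave the hyperplane transversally, so these variables are local coordinates by the
inverse function theorem. Then f = c + t satisfies df = p, hence |df| = 1 (`exists_eikonal`).

This needs a flow that is smooth jointly in time and initial point. `exists_smooth_local_flow`
obtains it from the inverse function theorem in C([0,1], W), where γ ↦ X ∘ γ is smooth
(`ContinuousMap.contDiff_comp_left`). `exists_eikonal_of_metric` and `norm_sq_riemannianGradient`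
carry the result to the manifold. -/

open Set Metric Filter Topology

/-! ### Smoothness of superposition operators -/

section Nemytskii

universe u

variable {K : Type*} [TopologicalSpace K] [CompactSpace K]
  {E F G : Type u} [NormedAddCommGroup E] [NormedSpace ℝ E] [NormedAddCommGroup F]
  [NormedSpace ℝ F] [NormedAddCommGroup G] [NormedSpace ℝ G]

variable (K) in
/-- The bilinear map on spaces of continuous functions induced pointwise by a bilinear map. -/
noncomputable def ContinuousMap.pointwiseBilin (B : G →L[ℝ] E →L[ℝ] F) :
    C(K, G) →L[ℝ] C(K, E) →L[ℝ] C(K, F) :=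
  LinearMap.mkContinuous₂
    (LinearMap.mk₂ ℝ (fun (f : C(K, G)) (h : C(K, E)) ↦
        (⟨fun t ↦ B (f t) (h t), by fun_prop⟩ : C(K, F)))
      (fun _ _ _ ↦ by ext; simp) (fun _ _ _ ↦ by ext; simp)
      (fun _ _ _ ↦ by ext; simp) (fun _ _ _ ↦ by ext; simp))
    ‖B‖ (fun f h ↦ by
      refine (ContinuousMap.norm_le _ (by positivity)).2 fun t ↦ ?_
      refine (B.le_opNorm₂ (f t) (h t)).trans ?_
      gcongr
      exacts [f.norm_coe_le_norm t, h.norm_coe_le_norm t])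

/-- The superposition operator of a `C^1` map is differentiable. The derivative of the map is
factored through a space `G` of operators. -/
theorem ContinuousMap.hasFDerivAt_comp_left (B : G →L[ℝ] E →L[ℝ] F) (v : C(E, F)) (v' : C(E, G))
    (hv : ∀ x, HasFDerivAt v (B (v' x)) x) (γ : C(K, E)) :
    HasFDerivAt (fun γ : C(K, E) ↦ v.comp γ)
      (ContinuousMap.pointwiseBilin K B (v'.comp γ)) γ := by
  have hcont : Continuous (fun γ : C(K, E) ↦ v'.comp γ) := ContinuousMap.continuous_postcomp v'
  rw [hasFDerivAt_iff_isLittleO_nhds_zero, Asymptotics.isLittleO_iff]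
  intro c hc
  obtain ⟨d, hd0, hd⟩ : ∃ d > 0, ‖B‖ * d ≤ c := by
    refine ⟨c / (‖B‖ + 1), by positivity, ?_⟩
    rw [mul_div_assoc', div_le_iff₀ (by positivity)]
    nlinarith [norm_nonneg B]
  obtain ⟨δ, hδ, hball⟩ := Metric.continuousAt_iff.1 (hcont.continuousAt (x := γ)) d hd0
  filter_upwards [Metric.ball_mem_nhds (0 : C(K, E)) hδ] with h hh
  rw [mem_ball_zero_iff] at hh
  refine (ContinuousMap.norm_le _ (by positivity)).2 fun t ↦ ?_
  -- The segment at t is swept out by the curves γ + θh, all within δ of γ in the sup norm.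
  -- Continuity of γ ↦ v' ∘ γ therefore bounds the variation of the derivative uniformly in t,
  -- without local compactness of E.
  have key : ∀ x ∈ segment ℝ (γ t) (γ t + h t), ‖B (v' x) - B (v' (γ t))‖ ≤ c := by
    intro x hx
    rw [segment_eq_image'] at hx
    obtain ⟨θ, hθ, rfl⟩ := hx
    have h1 : dist (γ + θ • h) γ < δ := by
      rw [dist_eq_norm, add_sub_cancel_left, norm_smul, Real.norm_eq_abs, abs_of_nonneg hθ.1]
      exact lt_of_le_of_lt (mul_le_of_le_one_left (norm_nonneg _) hθ.2) hh
    have h2 := (ContinuousMap.dist_apply_le_dist t).trans (hball h1).le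
    rw [← map_sub]
    refine (B.le_opNorm _).trans (le_trans ?_ hd)
    gcongr
    simpa [dist_eq_norm] using h2
  have := (convex_segment (γ t) (γ t + h t)).norm_image_sub_le_of_norm_hasFDerivWithin_le'
    (fun x _ ↦ (hv x).hasFDerivWithinAt) key
    (left_mem_segment ℝ _ _) (right_mem_segment ℝ _ _)
  rw [add_sub_cancel_left] at this
  exact this.trans (mul_le_mul_of_nonneg_left (h.norm_coe_le_norm t) hc.le)

theorem ContinuousMap.contDiff_succ_comp_left {n : ℕ} (B : G →L[ℝ] E →L[ℝ] F) (v : C(E, F))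
    (v' : C(E, G)) (hv : ∀ x, HasFDerivAt v (B (v' x)) x)
    (hn : ContDiff ℝ n (fun γ : C(K, E) ↦ v'.comp γ)) :
    ContDiff ℝ (n + 1 : ℕ) (fun γ : C(K, E) ↦ v.comp γ) := by
  have hd := fun γ : C(K, E) ↦ ContinuousMap.hasFDerivAt_comp_left B v v' hv γ
  push_cast
  rw [contDiff_succ_iff_fderiv]
  refine ⟨fun γ ↦ (hd γ).differentiableAt, by simp, ?_⟩
  rw [funext fun γ ↦ (hd γ).fderiv]
  exact (ContinuousMap.pointwiseBilin K B).contDiff.comp hn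

/-- The superposition operator `γ ↦ v ∘ γ` on continuous maps from a compact space is smooth
if `v` is smooth. -/
theorem ContinuousMap.contDiff_comp_left (v : C(E, F)) (hv : ContDiff ℝ ∞ v) :
    ContDiff ℝ ∞ (fun γ : C(K, E) ↦ v.comp γ) := by
  rw [contDiff_infty]
  intro n
  -- The induction hypothesis is applied to the derivative, whose values lie in E →L[ℝ] F; this is
  -- why E and F share a universe.
  induction n generalizing F with
  | zero => exact contDiff_zero.2 (ContinuousMap.continuous_postcomp v)
  | succ n ih =>
    have hv' : ContDiff ℝ ∞ (fderiv ℝ v) := hv.fderiv_right (by simp)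
    exact ContinuousMap.contDiff_succ_comp_left (.id ℝ _) v ⟨_, hv'.continuous⟩
      (fun x ↦ (hv.differentiable (by simp) x).hasFDerivAt) (ih ⟨_, hv'.continuous⟩ hv')

end Nemytskii

/-! ### Smooth inverse function theorem -/

section InverseFunction

variable {E F : Type*} [NormedAddCommGroup E] [NormedSpace ℝ E] [CompleteSpace E]
  [NormedAddCommGroup F] [NormedSpace ℝ F]

/-- Smooth inverse function theorem: the local inverse is smooth on a whole neighbourhood. -/
theorem ContDiffOn.exists_openPartialHomeomorph {f : E → F} {U : Set E} (hU : IsOpen U)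
    (hf : ContDiffOn ℝ ∞ f U) {a : E} (ha : a ∈ U) {f' : E ≃L[ℝ] F}
    (hf' : HasFDerivAt f (f' : E →L[ℝ] F) a) :
    ∃ e : OpenPartialHomeomorph E F, ⇑e = f ∧ a ∈ e.source ∧ e.source ⊆ U ∧
      (∀ x ∈ e.source, ∃ L : E ≃L[ℝ] F, HasFDerivAt f (L : E →L[ℝ] F) x) ∧
      ContDiffOn ℝ ∞ e.symm e.target := by
  have hfa : ContDiffAt ℝ ∞ f a := hf.contDiffAt (hU.mem_nhds ha)
  set e₀ := hfa.toOpenPartialHomeomorph f hf' (by simp)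
  -- Invertibility of the derivative is an open condition, so after restriction to V the inverse is
  -- smooth at every point of the target.
  set V : Set E := U ∩ fderiv ℝ f ⁻¹' range ((↑) : (E ≃L[ℝ] F) → E →L[ℝ] F)
  have hVo : IsOpen V :=
    (hf.continuousOn_fderiv_of_isOpen hU (by simp)).isOpen_inter_preimage hU
      ContinuousLinearEquiv.isOpen
  have hVd : ∀ x ∈ V, ∃ L : E ≃L[ℝ] F, HasFDerivAt f (L : E →L[ℝ] F) x := by
    rintro x ⟨hxU, L, hL⟩
    refine ⟨L, ?_⟩
    rw [hL]
    exact ((hf.contDiffAt (hU.mem_nhds hxU)).differentiableAt (by simp)).hasFDerivAt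
  refine ⟨e₀.restrOpen V hVo, rfl, ⟨hfa.mem_toOpenPartialHomeomorph_source hf' (by simp), ha, f',
    hf'.fderiv.symm⟩, fun x hx ↦ hx.2.1, fun x hx ↦ hVd x hx.2, fun y hy ↦ ?_⟩
  have hx := (e₀.restrOpen V hVo).map_target hy
  obtain ⟨L, hL⟩ := hVd _ hx.2
  exact ((e₀.restrOpen V hVo).contDiffAt_symm hy hL
    (hf.contDiffAt (hU.mem_nhds hx.2.1))).contDiffWithinAt

end InverseFunction

/-! ### Smooth local flows in Banach spaces -/

section Flow

variable {W : Type*} [NormedAddCommGroup W] [NormedSpace ℝ W]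

/-- The primitive vanishing at `0` of a continuous function on the unit interval, as a continuous
linear operator. -/
noncomputable def unitIntervalPrimitive (W : Type*) [NormedAddCommGroup W] [NormedSpace ℝ W] :
    C(unitInterval, W) →L[ℝ] C(unitInterval, W) :=
  LinearMap.mkContinuous
    { toFun := fun h ↦ ⟨fun τ ↦ ∫ u in (0 : ℝ)..τ, IccExtend zero_le_one h u,
        (intervalIntegral.continuous_primitive
          (fun a b ↦ h.continuous.Icc_extend'.intervalIntegrable a b) 0).comp
          continuous_subtype_val⟩
      map_add' := fun f g ↦ by
        ext τ
        exact intervalIntegral.integral_add (f.continuous.Icc_extend'.intervalIntegrable _ _)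
          (g.continuous.Icc_extend'.intervalIntegrable _ _)
      map_smul' := fun c f ↦ by
        ext τ
        exact intervalIntegral.integral_smul c _ }
    1 (fun h ↦ by
      refine (ContinuousMap.norm_le _ (by positivity)).2 fun τ ↦ ?_
      have := intervalIntegral.norm_integral_le_of_norm_le_const (a := 0) (b := (τ : ℝ))
        (f := IccExtend zero_le_one h) (C := ‖h‖) fun x _ ↦ h.norm_coe_le_norm _
      rw [sub_zero, abs_of_nonneg τ.2.1] at this
      rw [one_mul]
      exact this.trans (mul_le_of_le_one_right (norm_nonneg _) τ.2.2))

/-- The defect of a curve on the unit interval as a solution of `γ' = s • X γ`, `γ 0 = z`. -/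
noncomputable def integralDefect (X : C(W, W)) (q : ℝ × W × C(unitInterval, W)) :
    C(unitInterval, W) :=
  q.2.2 - ContinuousMap.const _ q.2.1 - q.1 • unitIntervalPrimitive W (X.comp q.2.2)

theorem integralDefect_apply (X : C(W, W)) (s : ℝ) (z : W) (γ : C(unitInterval, W))
    (τ : unitInterval) :
    integralDefect X (s, z, γ) τ =
      γ τ - z - s • ∫ u in (0 : ℝ)..τ, X (IccExtend zero_le_one γ u) := rfl

/-- A reparametrisation of an integral curve on `[0, 1]` by `τ ↦ σ τ`. -/
noncomputable def ContinuousMap.rescale (γ : C(unitInterval, W)) (σ : unitInterval) :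
    C(unitInterval, W) :=
  ⟨fun τ ↦ γ (σ * τ), by fun_prop⟩

/-- Substituting u ↦ σu in the integral turns a solution for time s into one for time σs. This
recovers the intermediate points of a solution curve as endpoints of other solution curves. -/
theorem integralDefect_rescale (X : C(W, W)) (s : ℝ) (z : W) (γ : C(unitInterval, W))
    (h : integralDefect X (s, z, γ) = 0) (σ : unitInterval) :
    integralDefect X (σ * s, z, γ.rescale σ) = 0 := by
  ext τ
  have h1 := DFunLike.congr_fun h (σ * τ)
  rw [integralDefect_apply] at h1 ⊢
  refine Eq.trans ?_ h1
  have h2 : ∫ u in (0 : ℝ)..τ, X (IccExtend zero_le_one (γ.rescale σ) u) =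
      ∫ u in (0 : ℝ)..τ, X (IccExtend zero_le_one γ ((σ : ℝ) * u)) := by
    refine intervalIntegral.integral_congr fun u hu ↦ ?_
    rw [uIcc_of_le τ.2.1] at hu
    have hu' : u ∈ Icc (0 : ℝ) 1 := ⟨hu.1, hu.2.trans τ.2.2⟩
    have hsu : (σ : ℝ) * u ∈ Icc (0 : ℝ) 1 :=
      ⟨mul_nonneg σ.2.1 hu'.1, mul_le_one₀ σ.2.2 hu'.1 hu'.2⟩
    simp only [IccExtend_of_mem _ _ hu', IccExtend_of_mem _ _ hsu]
    rfl
  have h3 := intervalIntegral.smul_integral_comp_mul_left (a := 0) (b := (τ : ℝ))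
    (fun u ↦ X (IccExtend zero_le_one γ u)) (σ : ℝ)
  rw [mul_zero] at h3
  rw [h2, mul_comm, mul_smul, h3]
  rfl

/-- Constant curves depend linearly and continuously on the constant. -/
noncomputable def unitIntervalConst (W : Type*) [NormedAddCommGroup W] [NormedSpace ℝ W] :
    W →L[ℝ] C(unitInterval, W) where
  toFun := ContinuousMap.const _
  map_add' _ _ := rfl
  map_smul' _ _ := rfl
  cont := ContinuousMap.continuous_const'

theorem contDiff_integralDefect (X : C(W, W)) (hX : ContDiff ℝ ∞ X) :
    ContDiff ℝ ∞ (integralDefect X) := by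
  have h1 : ContDiff ℝ ∞ fun q : ℝ × W × C(unitInterval, W) ↦ X.comp q.2.2 :=
    (ContinuousMap.contDiff_comp_left X hX).comp (contDiff_snd.comp contDiff_snd)
  have h2 : ContDiff ℝ ∞ fun q : ℝ × W × C(unitInterval, W) ↦
      (ContinuousMap.const unitInterval q.2.1) :=
    (unitIntervalConst W).contDiff.comp (contDiff_fst.comp contDiff_snd)
  exact ((contDiff_snd.comp contDiff_snd).sub h2).sub
    (contDiff_fst.smul ((unitIntervalPrimitive W).contDiff.comp h1))

/-- The curve equation with its parameters adjoined. -/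
noncomputable def paramDefect (X : C(W, W)) (q : ℝ × W × C(unitInterval, W)) :
    ℝ × W × C(unitInterval, W) :=
  (q.1, q.2.1, integralDefect X q)

/-- At s = 0 the factor s kills the derivative of the nonlinear term. What remains is triangular,
(s, z, γ) ↦ (s, z, γ - z - s k), and is inverted explicitly. -/
theorem exists_hasFDerivAt_paramDefect (X : C(W, W)) (hX : ContDiff ℝ ∞ X) (z : W) :
    ∃ L : (ℝ × W × C(unitInterval, W)) ≃L[ℝ] (ℝ × W × C(unitInterval, W)),
      HasFDerivAt (paramDefect X)
        (L : (ℝ × W × C(unitInterval, W)) →L[ℝ] (ℝ × W × C(unitInterval, W)))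
        (0, z, ContinuousMap.const _ z) := by
  set V := ℝ × W × C(unitInterval, W)
  set a : V := (0, z, ContinuousMap.const _ z)
  set k : C(unitInterval, W) := unitIntervalPrimitive W (X.comp (ContinuousMap.const _ z))
  set p1 : V →L[ℝ] ℝ := .fst ℝ _ _
  set p2 : V →L[ℝ] W := (ContinuousLinearMap.fst ℝ _ _).comp (.snd ℝ _ _)
  set p3 : V →L[ℝ] C(unitInterval, W) := (ContinuousLinearMap.snd ℝ _ _).comp (.snd ℝ _ _)
  set c : V →L[ℝ] C(unitInterval, W) := (unitIntervalConst W).comp p2 + p1.smulRight k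
  have hR : HasFDerivAt (fun q : V ↦ unitIntervalPrimitive W (X.comp q.2.2))
      (fderiv ℝ (fun q : V ↦ unitIntervalPrimitive W (X.comp q.2.2)) a) a := by
    refine DifferentiableAt.hasFDerivAt (ContDiff.differentiable (n := ∞) ?_ (by simp) a)
    exact (unitIntervalPrimitive W).contDiff.comp
      ((ContinuousMap.contDiff_comp_left X hX).comp (contDiff_snd.comp contDiff_snd))
  have h3 : HasFDerivAt (integralDefect X) (p3 - c) a := by
    have := (p3.hasFDerivAt.sub ((unitIntervalConst W).comp p2).hasFDerivAt).sub
      ((p1.hasFDerivAt (x := a)).smul hR)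
    refine this.congr_fderiv ?_
    refine ContinuousLinearMap.ext fun q ↦ ?_
    change p3 q - unitIntervalConst W (p2 q) - ((0 : ℝ) • (fderiv ℝ
      (fun q : V ↦ unitIntervalPrimitive W (X.comp q.2.2)) a) q + p1 q • k) =
        p3 q - (unitIntervalConst W (p2 q) + p1 q • k)
    rw [zero_smul, zero_add, sub_sub]
  refine ⟨ContinuousLinearEquiv.equivOfInverse (p1.prod (p2.prod (p3 - c)))
    (p1.prod (p2.prod (p3 + c))) (fun q ↦ ?_) (fun q ↦ ?_), ?_⟩
  · change (q.1, q.2.1, (q.2.2 - c q) + c q) = q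
    simp
  · change (q.1, q.2.1, (q.2.2 + c q) - c q) = q
    simp
  · exact p1.hasFDerivAt.prodMk (p2.hasFDerivAt.prodMk h3)

/-- **Smooth dependence of solutions of differential equations on initial conditions**: a smooth
vector field on a Banach space has a smooth local flow around every point. -/
theorem exists_smooth_local_flow [CompleteSpace W] {X : W → W} (hX : ContDiff ℝ ∞ X)
    (z₀ : W) : ∃ δ > 0, ∃ φ : ℝ × W → W, ContDiffOn ℝ ∞ φ (ball (0, z₀) δ) ∧
      (∀ z ∈ ball z₀ δ, φ (0, z) = z) ∧
      ∀ t z, (t, z) ∈ ball ((0 : ℝ), z₀) δ → HasDerivAt (fun s ↦ φ (s, z)) (X (φ (t, z))) t := by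
  set Y : C(W, W) := ⟨X, hX.continuous⟩
  set c₀ : C(unitInterval, W) := ContinuousMap.const _ z₀
  obtain ⟨L, hL⟩ := exists_hasFDerivAt_paramDefect Y hX z₀
  have hsmooth : ContDiff ℝ ∞ (paramDefect Y) :=
    contDiff_fst.prodMk ((contDiff_fst.comp contDiff_snd).prodMk (contDiff_integralDefect Y hX))
  obtain ⟨e, he, hae, -, -, hesymm⟩ :=
    hsmooth.contDiffOn.exists_openPartialHomeomorph isOpen_univ (mem_univ _) hL
  have he0 : paramDefect Y (0, z₀, c₀) = (0, z₀, 0) := by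
    simp [paramDefect, integralDefect, c₀]
  obtain ⟨r, hr, hrs⟩ := Metric.isOpen_iff.1 e.open_source _ hae
  set ι : ℝ × W → ℝ × W × C(unitInterval, W) := fun q ↦ (q.1, q.2, 0)
  have hι : ContDiff ℝ ∞ ι := by fun_prop
  have hι0 : ι (0, z₀) = e (0, z₀, c₀) := by rw [he, he0]
  have htgt : ι (0, z₀) ∈ e.target := hι0 ▸ e.map_source hae
  -- Solutions are confined to a ball inside `e.source` because rescaling does not increase the
  -- distance to a constant curve. A rescaled solution then stays in the ball, and injectivity of
  -- `e` identifies it in `hresc`.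
  have hnhds : ι ⁻¹' (e.target ∩ e.symm ⁻¹' ball (0, z₀, c₀) r) ∈ 𝓝 ((0 : ℝ), z₀) := by
    refine hι.continuous.continuousAt.preimage_mem_nhds (inter_mem (e.open_target.mem_nhds htgt) ?_)
    refine (e.continuousAt_symm htgt).preimage_mem_nhds ?_
    rw [hι0, e.left_inv hae]
    exact ball_mem_nhds _ hr
  obtain ⟨δ, hδ, hball⟩ := Metric.mem_nhds_iff.1 hnhds
  set Γ : ℝ × W → C(unitInterval, W) := fun q ↦ (e.symm (ι q)).2.2
  have hΓ : ∀ q ∈ ball ((0 : ℝ), z₀) δ, e.symm (ι q) = (q.1, q.2, Γ q) ∧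
      integralDefect Y (q.1, q.2, Γ q) = 0 := by
    intro q hq
    have h1 : paramDefect Y (e.symm (ι q)) = ι q := by rw [← he]; exact e.right_inv (hball hq).1
    have h2 : e.symm (ι q) = (q.1, q.2, Γ q) :=
      Prod.ext (congrArg (·.1) h1) (Prod.ext (congrArg (·.2.1) h1) rfl)
    refine ⟨h2, ?_⟩
    rw [h2] at h1
    exact congrArg (·.2.2) h1
  have hresc : ∀ q ∈ ball ((0 : ℝ), z₀) δ, ∀ σ : unitInterval,
      Γ (σ * q.1, q.2) = (Γ q).rescale σ := by
    intro q hq σ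
    obtain ⟨h1, h2⟩ := hΓ q hq
    have h3 : dist (e.symm (ι q)) (0, z₀, c₀) < r := (hball hq).2
    rw [h1] at h3
    simp only [Prod.dist_eq, max_lt_iff] at h3
    have hσs : dist ((σ : ℝ) * q.1) 0 ≤ dist q.1 0 := by
      rw [dist_zero_right, dist_zero_right, norm_mul]
      refine mul_le_of_le_one_left (norm_nonneg _) ?_
      rw [Real.norm_of_nonneg σ.2.1]
      exact σ.2.2
    have hd : dist ((Γ q).rescale σ) c₀ ≤ dist (Γ q) c₀ :=
      (ContinuousMap.dist_le dist_nonneg).2 fun τ ↦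
        ContinuousMap.dist_apply_le_dist (f := Γ q) (g := c₀) (σ * τ)
    have hmem : ((σ : ℝ) * q.1, q.2, (Γ q).rescale σ) ∈ e.source := by
      refine hrs ?_
      simp only [mem_ball, Prod.dist_eq, max_lt_iff]
      exact ⟨hσs.trans_lt h3.1, h3.2.1, hd.trans_lt h3.2.2⟩
    have h4 := e.left_inv hmem
    have h5 : e ((σ : ℝ) * q.1, q.2, (Γ q).rescale σ) = ι (σ * q.1, q.2) := by
      rw [he]
      simp only [paramDefect, ι, integralDefect_rescale Y _ _ _ h2 σ]
    rw [h5] at h4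
    exact congrArg (·.2.2) h4
  set φ : ℝ × W → W := fun q ↦ Γ q 1
  have hφ : ContDiffOn ℝ ∞ φ (ball (0, z₀) δ) := by
    have h1 : ContDiffOn ℝ ∞ (fun q ↦ e.symm (ι q)) (ball ((0 : ℝ), z₀) δ) :=
      hesymm.comp hι.contDiffOn fun q hq ↦ (hball hq).1
    exact (ContinuousMap.evalCLM ℝ (1 : unitInterval)).contDiff.comp_contDiffOn h1.snd.snd
  -- By `hresc`, the curve for time s at parameter u is φ (su, z); a change of variables gives the
  -- integral equation in true time.
  have hint : ∀ q ∈ ball ((0 : ℝ), z₀) δ, φ q = q.2 + ∫ u in (0 : ℝ)..q.1, X (φ (u, q.2)) := by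
    intro q hq
    have h1 := DFunLike.congr_fun (hΓ q hq).2 1
    rw [integralDefect_apply] at h1
    have h2 : ∫ u in (0 : ℝ)..(1 : unitInterval), Y (IccExtend zero_le_one (Γ q) u) =
        ∫ u in (0 : ℝ)..1, X (φ (q.1 * u, q.2)) := by
      refine intervalIntegral.integral_congr fun u hu ↦ ?_
      rw [Icc.coe_one, uIcc_of_le zero_le_one] at hu
      have := hresc q hq ⟨u, hu⟩
      simp only [IccExtend_of_mem _ _ hu, φ, mul_comm q.1 u, this, ContinuousMap.rescale,
        ContinuousMap.coe_mk, mul_one]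
      rfl
    have h3 := intervalIntegral.smul_integral_comp_mul_left (a := 0) (b := 1)
      (fun u ↦ X (φ (u, q.2))) q.1
    rw [h2, h3, mul_zero, mul_one] at h1
    rw [← sub_eq_zero, ← sub_sub]
    exact h1
  refine ⟨δ, hδ, φ, hφ, fun z hz ↦ ?_, fun t z htz ↦ ?_⟩
  · have := hint (0, z) (by simpa [Prod.dist_eq, hδ] using hz)
    simpa using this
  · have hmem : ∀ s, (s, z) ∈ ball ((0 : ℝ), z₀) δ ↔ s ∈ ball (0 : ℝ) δ := by
      intro s
      have : dist z z₀ < δ := (le_max_right _ _).trans_lt htz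
      simp [Prod.dist_eq, this]
    have ht : t ∈ ball (0 : ℝ) δ := (hmem t).1 htz
    have hcont : ContinuousOn (fun s ↦ X (φ (s, z))) (ball (0 : ℝ) δ) :=
      hX.continuous.comp_continuousOn (hφ.continuousOn.comp (by fun_prop) fun s hs ↦ (hmem s).2 hs)
    have hsub : uIcc 0 t ⊆ ball (0 : ℝ) δ :=
      (convex_ball (0 : ℝ) δ).ordConnected.uIcc_subset (mem_ball_self hδ) ht
    have hderiv := intervalIntegral.integral_hasDerivAt_right
      (hcont.mono hsub).intervalIntegrable
      (hcont.stronglyMeasurableAtFilter isOpen_ball t ht)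
      (hcont.continuousAt (isOpen_ball.mem_nhds ht))
    refine (hderiv.const_add z).congr_of_eventuallyEq ?_
    filter_upwards [isOpen_ball.mem_nhds ht] with s hs
    exact hint (s, z) ((hmem s).2 hs)

end Flow

/-! ### Characteristics of the eikonal equation -/

section Characteristics

set_option synthInstance.maxHeartbeats 200000

variable {E : Type*} [NormedAddCommGroup E] [NormedSpace ℝ E]

/-- The quadratic function `(x, p) ↦ p (A x p)` on the cotangent space defined by a cometric. -/
noncomputable def cometricForm (A : E → (E →L[ℝ] ℝ) →L[ℝ] E) (q : E × (E →L[ℝ] ℝ)) : ℝ :=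
  q.2 (A q.1 q.2)

/-- The Hamiltonian vector field of one half of the quadratic function of a cometric. -/
noncomputable def geodesicField (A : E → (E →L[ℝ] ℝ) →L[ℝ] E) (q : E × (E →L[ℝ] ℝ)) :
    E × (E →L[ℝ] ℝ) :=
  (A q.1 q.2, -(1 / 2 : ℝ) • (fderiv ℝ (cometricForm A) q).comp (.inl ℝ E (E →L[ℝ] ℝ)))

variable {A : E → (E →L[ℝ] ℝ) →L[ℝ] E}

theorem contDiff_cometricForm (hA : ContDiff ℝ ∞ A) : ContDiff ℝ ∞ (cometricForm A) :=
  contDiff_snd.clm_apply ((hA.comp contDiff_fst).clm_apply contDiff_snd)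

theorem contDiff_geodesicField (hA : ContDiff ℝ ∞ A) : ContDiff ℝ ∞ (geodesicField A) := by
  have h : ContDiff ℝ ∞ (fderiv ℝ (cometricForm A)) :=
    (contDiff_cometricForm hA).fderiv_right (by simp)
  exact ((hA.comp contDiff_fst).clm_apply contDiff_snd).prodMk
    ((h.clm_comp contDiff_const).const_smul _)

/-- Symmetry of A merges the two terms of the fibre derivative of the quadratic form. Half of it is
then the velocity component of `geodesicField`, which makes that field Hamiltonian. -/
theorem fderiv_cometricForm (hA : ContDiff ℝ ∞ A)
    (hs : ∀ (x : E) (p q : E →L[ℝ] ℝ), p (A x q) = q (A x p)) (q v : E × (E →L[ℝ] ℝ)) :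
    fderiv ℝ (cometricForm A) q v =
      fderiv ℝ (cometricForm A) q (v.1, 0) + 2 * v.2 (A q.1 q.2) := by
  have h1 : HasFDerivAt (fun p : E →L[ℝ] ℝ ↦ (q.1, p)) (.inr ℝ E (E →L[ℝ] ℝ)) q.2 :=
    hasFDerivAt_prodMk_right _ _
  have h2 : HasFDerivAt (cometricForm A) (fderiv ℝ (cometricForm A) q) (q.1, q.2) :=
    ((contDiff_cometricForm hA).differentiable (by simp) q).hasFDerivAt
  have h3 := h2.comp q.2 h1
  have h4 := (hasFDerivAt_id q.2).clm_apply ((A q.1).hasFDerivAt (x := q.2))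
  have h5 := DFunLike.congr_fun (h3.unique h4) v.2
  have h6 : fderiv ℝ (cometricForm A) q (0, v.2) = 2 * v.2 (A q.1 q.2) := by
    have : fderiv ℝ (cometricForm A) q (0, v.2) = q.2 (A q.1 v.2) + v.2 (A q.1 q.2) := by
      simpa using h5
    rw [this, hs q.1 q.2 v.2]
    ring
  rw [← h6, ← map_add]
  simp

variable {V : Type*} [NormedAddCommGroup V] [NormedSpace ℝ V]

/-- The quadratic function is conserved along the geodesic flow. -/
theorem fderiv_cometricForm_geodesicField (hA : ContDiff ℝ ∞ A)
    (hs : ∀ (x : E) (p q : E →L[ℝ] ℝ), p (A x q) = q (A x p)) (q : E × (E →L[ℝ] ℝ)) :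
    fderiv ℝ (cometricForm A) q (geodesicField A q) = 0 := by
  rw [fderiv_cometricForm hA hs]
  simp [geodesicField]

/-- If a family `Ψ = (x, p)` of points of the unit cotangent bundle is moved by the geodesic flow in
the direction `T`, then the pullback of the tautological one-form is invariant under this motion. -/
theorem exists_hasFDerivAt_tautologicalForm (hA : ContDiff ℝ ∞ A)
    (hs : ∀ (x : E) (p q : E →L[ℝ] ℝ), p (A x q) = q (A x p)) {Ψ : V → E × (E →L[ℝ] ℝ)} {a T : V}
    (hΨ : ContDiffAt ℝ ∞ Ψ a)
    (hT : ∀ᶠ b in 𝓝 a, fderiv ℝ Ψ b T = geodesicField A (Ψ b))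
    (hK : ∀ᶠ b in 𝓝 a, cometricForm A (Ψ b) = 1) (η : V) :
    ∃ D : V →L[ℝ] ℝ, HasFDerivAt (fun b ↦ (Ψ b).2 (fderiv ℝ Ψ b η).1) D a ∧ D T = 0 := by
  have hΨ1 : HasFDerivAt Ψ (fderiv ℝ Ψ a) a := (hΨ.differentiableAt (by simp)).hasFDerivAt
  have hΨ2 : HasFDerivAt (fderiv ℝ Ψ) (fderiv ℝ (fderiv ℝ Ψ) a) a :=
    ((hΨ.fderiv_right (m := ∞) (by simp)).differentiableAt (by simp)).hasFDerivAt
  have hsymm : fderiv ℝ (fderiv ℝ Ψ) a T η = fderiv ℝ (fderiv ℝ Ψ) a η T :=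
    (hΨ.isSymmSndFDerivAt (by simpa using ENat.LEInfty.out)).eq T η
  have hw : ∀ ζ : V, HasFDerivAt (fun b ↦ (Ψ b).2 (fderiv ℝ Ψ b ζ).1) _ a := fun ζ ↦
    hΨ1.snd.clm_apply (hΨ2.clm_apply (hasFDerivAt_const ζ a)).fst
  refine ⟨_, hw η, ?_⟩
  -- Write Ψ = (x, p). Differentiating p(∂_T x) = 1 and |p|² = 1 along η gives `h2` and `h3`. With
  -- p's equation of motion and ∂_T∂_η x = ∂_η∂_T x, they cancel both terms of D T.
  have h1 : ∀ᶠ b in 𝓝 a, (Ψ b).2 (fderiv ℝ Ψ b T).1 = 1 := by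
    filter_upwards [hT, hK] with b hb hb'
    rw [hb]
    exact hb'
  have h2 := DFunLike.congr_fun
    ((hw T).unique ((hasFDerivAt_const (1 : ℝ) a).congr_of_eventuallyEq h1)) η
  have h3 : fderiv ℝ (cometricForm A) (Ψ a) (fderiv ℝ Ψ a η) = 0 := by
    have h := ((contDiff_cometricForm hA).differentiable (by simp) (Ψ a)).hasFDerivAt.comp a hΨ1
    exact DFunLike.congr_fun
      (h.unique ((hasFDerivAt_const (1 : ℝ) a).congr_of_eventuallyEq hK)) η
  rw [fderiv_cometricForm hA hs] at h3
  have h4 := hT.self_of_nhds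
  simp [h4, geodesicField] at h2 ⊢
  rw [hsymm]
  linarith

theorem eq_of_forall_hasFDerivAt_eq_zero {g : ℝ × E → ℝ} {x₀ : E} {δ : ℝ}
    (hg : ∀ b ∈ ball ((0 : ℝ), x₀) δ, ∃ D : ℝ × E →L[ℝ] ℝ, HasFDerivAt g D b ∧ D (1, 0) = 0)
    {t : ℝ} {y : E} (hty : (t, y) ∈ ball ((0 : ℝ), x₀) δ) : g (t, y) = g (0, y) := by
  have hy : dist y x₀ < δ := (le_max_right _ _).trans_lt hty
  have ht : dist t 0 < δ := (le_max_left _ _).trans_lt hty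
  have hd : ∀ s ∈ ball (0 : ℝ) δ, HasDerivAt (fun s ↦ g (s, y)) 0 s := by
    intro s hs
    obtain ⟨D, hD, hD0⟩ := hg (s, y) (by simpa [Prod.dist_eq, hy] using hs)
    have := hD.comp_hasDerivAt s ((hasDerivAt_id s).prodMk (hasDerivAt_const s y))
    rwa [hD0] at this
  exact isOpen_ball.is_const_of_deriv_eq_zero (convex_ball (0 : ℝ) δ).isPreconnected
    (fun s hs ↦ (hd s hs).differentiableAt.differentiableWithinAt) (fun s hs ↦ (hd s hs).deriv)
    ht (mem_ball_self (dist_nonneg.trans_lt hy))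

/-- The family of unit speed characteristics issuing from the level sets of `ℓ`. -/
theorem exists_characteristics [CompleteSpace E] (hA : ContDiff ℝ ∞ A)
    (hs : ∀ (x : E) (p q : E →L[ℝ] ℝ), p (A x q) = q (A x p))
    (ℓ : E →L[ℝ] ℝ) (hℓ : ∀ x, 0 < ℓ (A x ℓ)) (x₀ : E) :
    ∃ δ > 0, ∃ Ψ : ℝ × E → E × (E →L[ℝ] ℝ), ∃ lam : E → ℝ,
      ContDiffOn ℝ ∞ Ψ (ball (0, x₀) δ) ∧ 0 < lam x₀ ∧
      (∀ y, (0, y) ∈ ball ((0 : ℝ), x₀) δ → Ψ (0, y) = (y, lam y • ℓ)) ∧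
      (∀ b ∈ ball (0, x₀) δ, fderiv ℝ Ψ b (1, 0) = geodesicField A (Ψ b)) ∧
      (∀ b ∈ ball (0, x₀) δ, cometricForm A (Ψ b) = 1) := by
  set lam : E → ℝ := fun y ↦ (√(ℓ (A y ℓ)))⁻¹ with hlam
  have hlampos : ∀ y, 0 < lam y := fun y ↦ inv_pos.2 (Real.sqrt_pos.2 (hℓ y))
  have hlamsq : ∀ y, lam y * lam y * ℓ (A y ℓ) = 1 := by
    intro y
    have h := Real.mul_self_sqrt (hℓ y).le
    have h' := (Real.sqrt_pos.2 (hℓ y)).ne'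
    simp only [hlam]
    nth_rewrite 3 [← h]
    field_simp
  have hlams : ContDiff ℝ ∞ lam :=
    ((contDiff_const.clm_apply (hA.clm_apply contDiff_const)).sqrt fun y ↦ (hℓ y).ne').inv
      fun y ↦ (Real.sqrt_pos.2 (hℓ y)).ne'
  set ζ : E → E × (E →L[ℝ] ℝ) := fun y ↦ (y, lam y • ℓ)
  have hζ : ContDiff ℝ ∞ ζ := contDiff_id.prodMk (hlams.smul contDiff_const)
  obtain ⟨r, hr, φ, hφ, hφ0, hφt⟩ := exists_smooth_local_flow (contDiff_geodesicField hA) (ζ x₀)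
  set j : ℝ × E → ℝ × (E × (E →L[ℝ] ℝ)) := fun b ↦ (b.1, ζ b.2)
  have hj : ContDiff ℝ ∞ j := contDiff_fst.prodMk (hζ.comp contDiff_snd)
  obtain ⟨δ, hδ, hsub⟩ := Metric.mem_nhds_iff.1
    (hj.continuous.continuousAt.preimage_mem_nhds (ball_mem_nhds (j (0, x₀)) hr))
  have hΨ : ContDiffOn ℝ ∞ (fun b ↦ φ (j b)) (ball (0, x₀) δ) :=
    hφ.comp hj.contDiffOn hsub
  have hd : ∀ b ∈ ball ((0 : ℝ), x₀) δ, HasFDerivAt (fun b ↦ φ (j b))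
      (fderiv ℝ (fun b ↦ φ (j b)) b) b := fun b hb ↦
    ((hΨ.contDiffAt (isOpen_ball.mem_nhds hb)).differentiableAt (by simp)).hasFDerivAt
  have h0 : ∀ y, (0, y) ∈ ball ((0 : ℝ), x₀) δ → φ (j (0, y)) = (y, lam y • ℓ) := fun y hy ↦
    hφ0 _ (mem_ball.2 ((le_max_right _ _).trans_lt (mem_ball.1 (hsub hy))))
  have hT : ∀ b ∈ ball ((0 : ℝ), x₀) δ,
      fderiv ℝ (fun b ↦ φ (j b)) b (1, 0) = geodesicField A (φ (j b)) := by
    rintro ⟨t, y⟩ hb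
    have h := (hd _ hb).comp_hasDerivAt t ((hasDerivAt_id t).prodMk (hasDerivAt_const t y))
    exact h.unique (hφt t (ζ y) (hsub hb))
  refine ⟨δ, hδ, fun b ↦ φ (j b), lam, hΨ, hlampos _, h0, hT, ?_⟩
  rintro ⟨t, y⟩ hb
  have hy : ((0 : ℝ), y) ∈ ball ((0 : ℝ), x₀) δ := by
    have hy : dist y x₀ < δ := (le_max_right _ _).trans_lt hb
    simpa [Prod.dist_eq, hδ] using hy
  rw [eq_of_forall_hasFDerivAt_eq_zero (g := fun b ↦ cometricForm A (φ (j b))) (fun b hb ↦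
    ⟨_, ((contDiff_cometricForm hA).differentiable (by simp) _).hasFDerivAt.comp b (hd b hb), ?_⟩)
    hb, h0 y hy]
  · simpa [cometricForm, mul_assoc] using hlamsq y
  · rw [ContinuousLinearMap.comp_apply, hT b hb]
    exact fderiv_cometricForm_geodesicField hA hs _

/-- Local solvability of the eikonal equation in a Banach space, with constant boundary values on a
hyperplane. -/
theorem exists_eikonal [CompleteSpace E] (hA : ContDiff ℝ ∞ A)
    (hs : ∀ (x : E) (p q : E →L[ℝ] ℝ), p (A x q) = q (A x p))
    (ℓ : E →L[ℝ] ℝ) (hℓ : ∀ x, 0 < ℓ (A x ℓ)) (x₀ : E)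
    (hx₀ : ℓ x₀ = 0) (c : ℝ) :
    ∃ U : Set E, IsOpen U ∧ x₀ ∈ U ∧ ∃ f : E → ℝ, ContDiffOn ℝ ∞ f U ∧
      (∀ x ∈ U, fderiv ℝ f x (A x (fderiv ℝ f x)) = 1) ∧ ∀ x ∈ U, ℓ x = 0 → f x = c := by
  obtain ⟨δ, hδ, Ψ, lam, hΨ, hlam, hΨ0, hΨT, hΨK⟩ := exists_characteristics hA hs ℓ hℓ x₀
  set B : Set (ℝ × E) := ball (0, x₀) δ
  have hB : IsOpen B := isOpen_ball
  have hBa : ∀ b ∈ B, ContDiffAt ℝ ∞ Ψ b := fun b hb ↦ hΨ.contDiffAt (hB.mem_nhds hb)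
  have hBd : ∀ b ∈ B, HasFDerivAt Ψ (fderiv ℝ Ψ b) b := fun b hb ↦
    ((hBa b hb).differentiableAt (by simp)).hasFDerivAt
  have hinit : ∀ y, (0, y) ∈ B → ∀ η, (fderiv ℝ Ψ (0, y) (0, η)).1 = η := by
    intro y hy η
    have h1 := ((hBd _ hy).comp y (hasFDerivAt_prodMk_right (𝕜 := ℝ) (0 : ℝ) y)).fst
    have h2 : ∀ᶠ y' in 𝓝 y, (Ψ (0, y')).1 = y' := by
      filter_upwards [(Continuous.prodMk_right (0 : ℝ)).continuousAt.preimage_mem_nhds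
        (hB.mem_nhds hy)] with y' hy'
      rw [hΨ0 y' hy']
    exact DFunLike.congr_fun (h1.unique ((hasFDerivAt_id y).congr_of_eventuallyEq h2)) η
  -- The tautological form pulls back to dt + lam ℓ: its time component is |p|² = 1, and the others
  -- keep their values from time 0.
  have hform : ∀ b ∈ B, ∀ τ η, (Ψ b).2 (fderiv ℝ Ψ b (τ, η)).1 = τ + lam b.2 * ℓ η := by
    rintro ⟨t, y⟩ hb τ η
    have hy : (0, y) ∈ B := by
      have hy : dist y x₀ < δ := (le_max_right _ _).trans_lt hb
      simpa [B, Prod.dist_eq, hδ] using hy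
    have h1 : (Ψ (t, y)).2 (fderiv ℝ Ψ (t, y) (1, 0)).1 = 1 := by
      rw [hΨT _ hb]
      exact hΨK _ hb
    have h2 := eq_of_forall_hasFDerivAt_eq_zero
      (fun b hb ↦ exists_hasFDerivAt_tautologicalForm hA hs (hBa b hb)
        (eventually_of_mem (hB.mem_nhds hb) hΨT) (eventually_of_mem (hB.mem_nhds hb) hΨK)
        ((0 : ℝ), η)) hb
    rw [hinit y hy, hΨ0 y hy] at h2
    have h3 : ((τ, η) : ℝ × E) = τ • ((1 : ℝ), (0 : E)) + (0, η) := by simp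
    rw [h3, map_add, map_smul, Prod.fst_add, Prod.smul_fst, map_add, map_smul, h1, h2]
    simp
  set w : E := A x₀ (lam x₀ • ℓ) with hw
  have hℓw : ℓ w ≠ 0 := by
    rw [hw, map_smul, map_smul, smul_eq_mul]
    exact (mul_pos hlam (hℓ x₀)).ne'
  set κ : ℝ := (ℓ w)⁻¹ with hκ
  -- Coordinates along w, the initial velocity at x₀, and ker ℓ: j w = (1, 0), and j is v ↦ (0, v)
  -- on ker ℓ. Hence Φ, which follows the characteristic from the foot for the given time, has
  -- identity derivative at x₀.
  set j : E →L[ℝ] ℝ × E := (κ • ℓ).prod (.id ℝ E - ℓ.smulRight (κ • w)) with hj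
  have hj_apply : ∀ v, j v = (κ * ℓ v, v - ℓ v • κ • w) := fun v ↦ rfl
  have hj0 : ∀ v, ℓ v = 0 → j v = (0, v) := fun v hv ↦ by simp [hj_apply, hv]
  have hjℓ : ∀ v, ℓ (j v).2 = 0 := fun v ↦ by
    simp [hj_apply, hκ, hℓw]
  set Φ : E → E := fun x ↦ (Ψ (j x)).1
  set U₀ : Set E := j ⁻¹' B
  have hU₀ : IsOpen U₀ := hB.preimage j.continuous
  have hxU₀ : x₀ ∈ U₀ := by
    change j x₀ ∈ B
    rw [hj0 x₀ hx₀]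
    exact mem_ball_self hδ
  have hΦ : ContDiffOn ℝ ∞ Φ U₀ :=
    (hΨ.comp j.contDiff.contDiffOn fun x hx ↦ hx).fst
  have hΦd : ∀ x ∈ U₀, HasFDerivAt Φ
      ((ContinuousLinearMap.fst ℝ _ _).comp ((fderiv ℝ Ψ (j x)).comp j)) x := fun x hx ↦
    ((hBd _ hx).comp x j.hasFDerivAt).fst
  have hΦid : HasFDerivAt Φ ((ContinuousLinearEquiv.refl ℝ E : E ≃L[ℝ] E) : E →L[ℝ] E) x₀ := by
    refine (hΦd x₀ hxU₀).congr_fderiv (ContinuousLinearMap.ext fun v ↦ ?_)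
    have hxB : (0, x₀) ∈ B := mem_ball_self hδ
    change (fderiv ℝ Ψ (j x₀) (j v)).1 = v
    have h3 : j v = (κ * ℓ v) • ((1 : ℝ), (0 : E)) + (0, v - ℓ v • κ • w) := by simp [hj_apply]
    rw [hj0 x₀ hx₀, h3, map_add, map_smul, Prod.fst_add, Prod.smul_fst, hinit _ hxB, hΨT _ hxB,
      hΨ0 _ hxB]
    change (κ * ℓ v) • w + (v - ℓ v • κ • w) = v
    rw [mul_comm, mul_smul]
    abel
  obtain ⟨e, he, hx₀e, hesub, heL, hesymm⟩ :=
    hΦ.exists_openPartialHomeomorph hU₀ hxU₀ hΦid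
  have hΦ0 : ∀ x ∈ U₀, ℓ x = 0 → Φ x = x := by
    intro x hx hx0
    have hx' : j x ∈ B := hx
    rw [hj0 x hx0] at hx'
    simp only [Φ, hj0 x hx0, hΨ0 x hx']
  set f : E → ℝ := fun x ↦ c + κ * ℓ (e.symm x)
  have hf : ContDiffOn ℝ ∞ f e.target :=
    contDiffOn_const.add (contDiffOn_const.mul (ℓ.contDiff.comp_contDiffOn hesymm))
  -- Membership in the source gives `e.symm x = x` on the hyperplane, since Φ fixes its points.
  refine ⟨e.target ∩ e.source, e.open_target.inter e.open_source, ⟨?_, hx₀e⟩, f,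
    hf.mono inter_subset_left, fun x hx ↦ ?_, fun x hx hx0 ↦ ?_⟩
  · have := e.map_source hx₀e
    rwa [he, hΦ0 x₀ hxU₀ hx₀] at this
  · set y := e.symm x
    have hy : y ∈ e.source := e.map_target hx.1
    have hyx : Φ y = x := by rw [← he]; exact e.right_inv hx.1
    have hyB : j y ∈ B := hesub hy
    have hfd : HasFDerivAt f (fderiv ℝ f x) (Φ y) := by
      rw [hyx]
      exact ((hf.contDiffAt (e.open_target.mem_nhds hx.1)).differentiableAt (by simp)).hasFDerivAt
    have h1 : ∀ᶠ y' in 𝓝 y, (f ∘ Φ) y' = c + κ * ℓ y' := by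
      filter_upwards [e.open_source.mem_nhds hy] with y' hy'
      simp only [f, Function.comp, ← he, e.left_inv hy']
    have h2 := (hfd.comp y (hΦd y (hesub hy))).unique
      (((ℓ.hasFDerivAt.const_mul κ).const_add c).congr_of_eventuallyEq h1)
    obtain ⟨L, hL⟩ := heL y hy
    have hLΦ := hL.unique (hΦd y (hesub hy))
    -- Both covectors agree after composition with the derivative of Φ, which is surjective: the lam
    -- ℓ term of `hform` vanishes because the foot moves in ker ℓ.
    have h3 : fderiv ℝ f x = (Ψ (j y)).2 := by
      refine ContinuousLinearMap.ext fun v ↦ ?_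
      obtain ⟨u, rfl⟩ := L.surjective v
      have h4 : (L u : E) = (fderiv ℝ Ψ (j y) (j u)).1 := DFunLike.congr_fun hLΦ u
      have h5 := DFunLike.congr_fun h2 u
      have h6 := hform _ hyB (j u).1 (j u).2
      rw [hjℓ, mul_zero, add_zero] at h6
      rw [h4]
      exact h5.trans h6.symm
    rw [h3]
    have := hΨK _ hyB
    rw [← hyx]
    exact this
  · have h1 : e.symm x = x := by
      have := e.left_inv hx.2
      rwa [he, hΦ0 x (hesub hx.2) hx0] at this
    simp [f, h1, hx0]

end Characteristics

/-! ### From a local metric to a global cometric -/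

section Metric

variable {E : Type*} [NormedAddCommGroup E] [InnerProductSpace ℝ E] [FiniteDimensional ℝ E]

theorem exists_continuousLinearEquiv_of_posDef (B : E →L[ℝ] E →L[ℝ] ℝ)
    (hB : ∀ v, v ≠ 0 → 0 < B v v) : ∃ e : E ≃L[ℝ] (E →L[ℝ] ℝ), (e : E →L[ℝ] E →L[ℝ] ℝ) = B := by
  have hinj : Function.Injective (B : E →ₗ[ℝ] E →L[ℝ] ℝ) := by
    refine (injective_iff_map_eq_zero _).2 fun v hv ↦ ?_
    by_contra h
    have h1 := hB v h
    have h2 : B v = 0 := hv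
    simp [h2] at h1
  have := FiniteDimensional.complete ℝ E
  have hfin : Module.finrank ℝ E = Module.finrank ℝ (E →L[ℝ] ℝ) :=
    (InnerProductSpace.toDual ℝ E).toLinearEquiv.finrank_eq
  refine ⟨(LinearEquiv.ofInjectiveOfFinrankEq _ hinj hfin).toContinuousLinearEquiv, ?_⟩
  ext1 v
  rfl

/-- A smooth function near a point agrees near the point with a smooth function whose values are
convex combinations with a given vector. -/
theorem exists_contDiff_blend {F : Type*} [NormedAddCommGroup F] [NormedSpace ℝ F] {G : E → F}
    {V : Set E} (hV : IsOpen V) (hG : ContDiffOn ℝ ∞ G V) {x₀ : E} (hx₀ : x₀ ∈ V) (g₀ : F) :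
    ∃ (χ : E → ℝ) (G' : E → F), ContDiff ℝ ∞ G' ∧ (∀ x, 0 ≤ χ x ∧ χ x ≤ 1) ∧ (∀ x ∉ V, χ x = 0) ∧
      (∀ x, G' x = χ x • G x + (1 - χ x) • g₀) ∧ ∀ᶠ x in 𝓝 x₀, G' x = G x := by
  obtain ⟨r, hr, hrV⟩ := Metric.isOpen_iff.1 hV x₀ hx₀
  let χ : ContDiffBump x₀ := ⟨r / 3, r / 2, by positivity, by linarith⟩
  have hχ0 : ∀ x ∉ V, χ x = 0 := fun x hx ↦ χ.zero_of_le_dist <| by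
    by_contra h
    refine hx (hrV ?_)
    rw [mem_ball]
    exact (not_le.1 h).trans (by change r / 2 < r; linarith)
  refine ⟨χ, fun x ↦ χ x • G x + (1 - χ x) • g₀, contDiff_iff_contDiffAt.2 fun x ↦ ?_,
    fun x ↦ ⟨χ.nonneg' x, χ.le_one⟩, hχ0, fun x ↦ rfl, ?_⟩
  · by_cases hx : x ∈ V
    · exact (χ.contDiff.contDiffAt.smul (hG.contDiffAt (hV.mem_nhds hx))).add
        ((contDiffAt_const.sub χ.contDiff.contDiffAt).smul contDiffAt_const)
    · have hx' : x ∉ tsupport χ := by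
        rw [χ.tsupport_eq, mem_closedBall, not_le]
        have : ¬ dist x x₀ < r := fun h ↦ hx (hrV h)
        change r / 2 < dist x x₀
        linarith
      refine (contDiffAt_const (c := g₀)).congr_of_eventuallyEq ?_
      filter_upwards [(isClosed_tsupport χ).isOpen_compl.mem_nhds hx'] with y hy
      rw [image_eq_zero_of_notMem_tsupport hy, zero_smul, sub_zero, one_smul, zero_add]
  · filter_upwards [χ.eventuallyEq_one] with x hx
    simp [hx]

/-- A smooth metric near a point agrees near the point with a metric on the whole space. -/
theorem exists_global_metric {G : E → E →L[ℝ] E →L[ℝ] ℝ} {V : Set E} (hV : IsOpen V)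
    (hG : ContDiffOn ℝ ∞ G V) (hsymm : ∀ x ∈ V, ∀ v w, G x v w = G x w v)
    (hpos : ∀ x ∈ V, ∀ v, v ≠ 0 → 0 < G x v v) {x₀ : E} (hx₀ : x₀ ∈ V) :
    ∃ G' : E → E →L[ℝ] E →L[ℝ] ℝ, ContDiff ℝ ∞ G' ∧ (∀ x v w, G' x v w = G' x w v) ∧
      (∀ x v, v ≠ 0 → 0 < G' x v v) ∧ ∀ᶠ x in 𝓝 x₀, G' x = G x := by
  obtain ⟨χ, G', hG', hχ, hχ0, hval, heq⟩ := exists_contDiff_blend hV hG hx₀ (innerSL ℝ)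
  have hval' : ∀ x v w, G' x v w = χ x * G x v w + (1 - χ x) * inner ℝ v w := fun x v w ↦
    congrArg (fun B : E →L[ℝ] E →L[ℝ] ℝ ↦ B v w) (hval x)
  refine ⟨G', hG', fun x v w ↦ ?_, fun x v hv ↦ ?_, heq⟩
  · rw [hval', hval', real_inner_comm]
    by_cases hx : x ∈ V
    · rw [hsymm x hx]
    · rw [hχ0 x hx, zero_mul, zero_mul]
  · have hvv : 0 < inner ℝ v v := real_inner_self_pos.2 hv
    rw [hval']
    rcases (hχ x).1.eq_or_lt with h | h
    · rwa [← h, zero_mul, zero_add, sub_zero, one_mul]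
    · have hx : x ∈ V := by
        by_contra hx
        exact h.ne' (hχ0 x hx)
      exact add_pos_of_pos_of_nonneg (mul_pos h (hpos x hx v hv))
        (mul_nonneg (sub_nonneg.2 (hχ x).2) hvv.le)

/-- Local solvability of the eikonal equation of a smooth metric on an open subset of a Euclidean
space. The gradient of the solution at `x` is the vector `u`. -/
theorem exists_eikonal_of_metric {G : E → E →L[ℝ] E →L[ℝ] ℝ} {V : Set E} (hV : IsOpen V)
    (hG : ContDiffOn ℝ ∞ G V) (hsymm : ∀ x ∈ V, ∀ v w, G x v w = G x w v)
    (hpos : ∀ x ∈ V, ∀ v, v ≠ 0 → 0 < G x v v) {x₀ : E} (hx₀ : x₀ ∈ V)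
    (ℓ : E →L[ℝ] ℝ) (hℓ : ℓ ≠ 0) (hℓx : ℓ x₀ = 0) (c : ℝ) :
    ∃ U ⊆ V, IsOpen U ∧ x₀ ∈ U ∧ ∃ f : E → ℝ, ContDiffOn ℝ ∞ f U ∧
      (∀ x ∈ U, ∃ u, G x u = fderiv ℝ f x ∧ fderiv ℝ f x u = 1) ∧ ∀ x ∈ U, ℓ x = 0 → f x = c := by
  have := FiniteDimensional.complete ℝ E
  obtain ⟨G', hG', hsymm', hpos', heq⟩ := exists_global_metric hV hG hsymm hpos hx₀
  choose e he using fun x ↦ exists_continuousLinearEquiv_of_posDef (G' x) (hpos' x)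
  have heG : ∀ x v, e x v = G' x v := fun x v ↦ by rw [← he x]; rfl
  -- G' is positive definite on all of E, so `inverse` is a true inverse everywhere and the cometric
  -- is globally smooth.
  set A : E → (E →L[ℝ] ℝ) →L[ℝ] E := fun x ↦ (G' x).inverse
  have hAe : ∀ x, A x = (e x).symm := fun x ↦ by
    simp only [A, ← he x, ContinuousLinearMap.inverse_equiv]
  have hA : ContDiff ℝ ∞ A := contDiff_iff_contDiffAt.2 fun x ↦ by
    have := contDiffAt_map_inverse (n := ∞) (e x)
    rw [he x] at this
    exact this.comp x hG'.contDiffAt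
  have hGA : ∀ x p, G' x (A x p) = p := fun x p ↦ by
    rw [hAe, ← heG]
    exact (e x).apply_symm_apply p
  obtain ⟨U, hU, hxU, f, hf, hfe, hfc⟩ := exists_eikonal hA (fun x p q ↦ by
    have h := hsymm' x (A x p) (A x q)
    rwa [hGA, hGA] at h) ℓ (fun x ↦ by
    have h := hpos' x (A x ℓ) fun h ↦ hℓ (by rw [← hGA x ℓ, h, map_zero])
    rwa [hGA] at h) x₀ hℓx c
  obtain ⟨O, hO, hOo, hxO⟩ := _root_.eventually_nhds_iff.1 (heq.and (hV.mem_nhds hx₀))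
  refine ⟨U ∩ O, fun x hx ↦ (hO x hx.2).2, hU.inter hOo, ⟨hxU, hxO⟩, f, hf.mono inter_subset_left,
    fun x hx ↦ ⟨A x (fderiv ℝ f x), ?_, hfe x hx.1⟩, fun x hx ↦ hfc x hx.1⟩
  rw [← (hO x hx.2).1, hGA]

end Metric

/-! ### The metric and the gradient in a chart -/

section Manifold

variable {m : ℕ} {M : Type*} [TopologicalSpace M] [ChartedSpace (EuclideanSpace ℝ (Fin m)) M]

theorem OpenPartialHomeomorph.mdifferentiable_of_mem_maximalAtlas
    {ψ : OpenPartialHomeomorph M (EuclideanSpace ℝ (Fin m))}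
    (hψ : ψ ∈ IsManifold.maximalAtlas (𝓡 m) ∞ M) : ψ.MDifferentiable (𝓡 m) (𝓡 m) :=
  ⟨(contMDiffOn_of_mem_maximalAtlas hψ).mdifferentiableOn (by simp),
    (contMDiffOn_symm_of_mem_maximalAtlas hψ).mdifferentiableOn (by simp)⟩

variable [Bundle.RiemannianBundle (fun x : M ↦ TangentSpace (𝓡 m) x)]

/-- The Riemannian metric of a manifold, read in a chart. -/
noncomputable def chartMetric (ψ : OpenPartialHomeomorph M (EuclideanSpace ℝ (Fin m)))
    (y : EuclideanSpace ℝ (Fin m)) :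
    EuclideanSpace ℝ (Fin m) →L[ℝ] EuclideanSpace ℝ (Fin m) →L[ℝ] ℝ :=
  (innerSL ℝ (E := TangentSpace (𝓡 m) (ψ.symm y))).bilinearComp
    (mfderiv (𝓡 m) (𝓡 m) ψ.symm y :
      EuclideanSpace ℝ (Fin m) →L[ℝ] TangentSpace (𝓡 m) (ψ.symm y))
    (mfderiv (𝓡 m) (𝓡 m) ψ.symm y)

theorem chartMetric_apply (ψ : OpenPartialHomeomorph M (EuclideanSpace ℝ (Fin m)))
    (y v w : EuclideanSpace ℝ (Fin m)) :
    chartMetric ψ y v w = inner ℝ (mfderiv (𝓡 m) (𝓡 m) ψ.symm y v)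
      (mfderiv (𝓡 m) (𝓡 m) ψ.symm y w) := rfl

variable {ψ : OpenPartialHomeomorph M (EuclideanSpace ℝ (Fin m))}

theorem chartMetric_pos (hψ : ψ ∈ IsManifold.maximalAtlas (𝓡 m) ∞ M)
    {y : EuclideanSpace ℝ (Fin m)} (hy : y ∈ ψ.target) (v : EuclideanSpace ℝ (Fin m))
    (hv : v ≠ 0) : 0 < chartMetric ψ y v v := by
  rw [chartMetric_apply, real_inner_self_pos]
  intro h
  exact hv ((OpenPartialHomeomorph.mdifferentiable_of_mem_maximalAtlas hψ).symm.mfderiv_injective hy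
    (h.trans (map_zero _).symm))

/-- The tangent map of `ψ.symm` sends constant fields to smooth sections along `ψ.symm`, whose inner
products are smooth. In finite dimension, testing on fixed vectors suffices. -/
theorem contDiffOn_chartMetric [IsManifold (𝓡 m) ∞ M]
    [IsContMDiffRiemannianBundle (𝓡 m) ∞ (EuclideanSpace ℝ (Fin m))
      (fun x : M ↦ TangentSpace (𝓡 m) x)]
    (hψ : ψ ∈ IsManifold.maximalAtlas (𝓡 m) ∞ M) :
    ContDiffOn ℝ ∞ (chartMetric ψ) ψ.target := by
  have hsec : ∀ v : EuclideanSpace ℝ (Fin m), ContMDiffOn (𝓡 m) (𝓡 m).tangent ∞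
      (fun y ↦ (⟨ψ.symm y, mfderiv (𝓡 m) (𝓡 m) ψ.symm y v⟩ : TangentBundle (𝓡 m) M))
      ψ.target := by
    intro v
    have h1 := (contMDiffOn_symm_of_mem_maximalAtlas hψ).contMDiffOn_tangentMapWithin (m := ∞)
      (by simp) ψ.open_target.uniqueMDiffOn
    have h2 : ContMDiffOn (𝓡 m) (𝓡 m).tangent ∞ (fun y : EuclideanSpace ℝ (Fin m) ↦
        (⟨y, v⟩ : TangentBundle (𝓡 m) (EuclideanSpace ℝ (Fin m)))) ψ.target :=
      contMDiffOn_vectorSpace_iff_contDiffOn.2 contDiffOn_const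
    refine (h1.comp h2 fun y hy ↦ hy).congr fun y hy ↦ ?_
    simp only [Function.comp, tangentMapWithin, mfderivWithin_of_isOpen ψ.open_target hy]
  refine contDiffOn_clm_apply.2 fun v ↦ contDiffOn_clm_apply.2 fun w ↦ ?_
  exact contMDiffOn_iff_contDiffOn.1 ((hsec v).inner_bundle (hsec w))

/-- If the differential of `f` in a chart is represented by the vector `u` through the metric in
the chart, then the squared length of the gradient of `f` is the value of the differential
at `u`. -/
theorem norm_sq_riemannianGradient (hψ : ψ ∈ IsManifold.maximalAtlas (𝓡 m) ∞ M)
    {f : EuclideanSpace ℝ (Fin m) → ℝ} {x : M} (hx : x ∈ ψ.source)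
    (hf : DifferentiableAt ℝ f (ψ x)) {u : EuclideanSpace ℝ (Fin m)}
    (hu : chartMetric ψ (ψ x) u = fderiv ℝ f (ψ x)) :
    ‖riemannianGradient m (f ∘ ψ) x‖ ^ 2 = fderiv ℝ f (ψ x) u := by
  obtain ⟨y, hy, rfl⟩ : ∃ y ∈ ψ.target, ψ.symm y = x := ⟨ψ x, ψ.map_source hx, ψ.left_inv hx⟩
  rw [ψ.right_inv hy] at hf hu ⊢
  have hψd := OpenPartialHomeomorph.mdifferentiable_of_mem_maximalAtlas hψ
  have hcomp : ∀ v : EuclideanSpace ℝ (Fin m), mfderiv (𝓡 m) 𝓘(ℝ, ℝ) (f ∘ ψ) (ψ.symm y)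
      (mfderiv (𝓡 m) (𝓡 m) ψ.symm y v) = fderiv ℝ f y v := by
    intro v
    have hf' : MDifferentiableAt (𝓡 m) 𝓘(ℝ, ℝ) f (ψ (ψ.symm y)) := by
      rw [ψ.right_inv hy]
      exact hf.mdifferentiableAt
    have h1 : mfderiv (𝓡 m) 𝓘(ℝ, ℝ) (f ∘ ψ) (ψ.symm y) =
        (mfderiv (𝓡 m) 𝓘(ℝ, ℝ) f (ψ (ψ.symm y))).comp
          (mfderiv (𝓡 m) (𝓡 m) ψ (ψ.symm y)) :=
      mfderiv_comp _ hf' (hψd.mdifferentiableAt hx)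
    have h2 := DFunLike.congr_fun (hψd.comp_symm_deriv hy) v
    rw [h1]
    change mfderiv (𝓡 m) 𝓘(ℝ, ℝ) f (ψ (ψ.symm y)) (mfderiv (𝓡 m) (𝓡 m) ψ (ψ.symm y)
      (mfderiv (𝓡 m) (𝓡 m) ψ.symm y v)) = _
    have h3 : mfderiv (𝓡 m) (𝓡 m) ψ (ψ.symm y) (mfderiv (𝓡 m) (𝓡 m) ψ.symm y v) = v := h2
    rw [h3, ψ.right_inv hy, mfderiv_eq_fderiv]
    rfl
  have hgrad : riemannianGradient m (f ∘ ψ) (ψ.symm y) = mfderiv (𝓡 m) (𝓡 m) ψ.symm y u := by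
    refine ext_inner_right ℝ fun w ↦ ?_
    obtain ⟨v, rfl⟩ := hψd.symm.mfderiv_surjective hy w
    refine (inner_riemannianGradient _ _ _).trans ((hcomp v).trans ?_)
    rw [← hu]
    rfl
  rw [← real_inner_self_eq_norm_sq, inner_riemannianGradient, hgrad]
  exact hcomp u

end Manifold

/-! ### Adapted charts and the theorem -/

/-- A hypersurface is locally contained in the zero set of a linear functional in a chart. -/
theorem IsHypersurface.exists_chart {n : ℕ} {M : Type*} [TopologicalSpace M]
    [ChartedSpace (EuclideanSpace ℝ (Fin (n + 1))) M] {S : Set M} (hS : IsHypersurface n S)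
    {p : M} (hp : p ∈ S) :
    ∃ ψ ∈ IsManifold.maximalAtlas (𝓡 (n + 1)) ∞ M, p ∈ ψ.source ∧
      ∃ ℓ : EuclideanSpace ℝ (Fin (n + 1)) →L[ℝ] ℝ, ℓ ≠ 0 ∧
        ∃ O : Set M, IsOpen O ∧ p ∈ O ∧ ∀ x ∈ O ∩ S, ℓ (ψ x) = 0 := by
  obtain ⟨_, _, hemb⟩ := hS
  have h := hemb.isImmersion.isImmersionAt ⟨p, hp⟩
  obtain ⟨O, hO, hOs⟩ := isOpen_induced_iff.1 h.domChart.open_source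
  -- A trivial complement would give n + 1 = n.
  have hnt : Nontrivial h.complement := by
    by_contra hc
    rw [not_nontrivial_iff_subsingleton] at hc
    have : Unique h.complement := uniqueOfSubsingleton 0
    have := (h.equiv.toLinearEquiv.symm.trans (LinearEquiv.prodUnique (R := ℝ)
      (M := EuclideanSpace ℝ (Fin n)) (M₂ := h.complement))).finrank_eq
    simp at this
  obtain ⟨a, ha⟩ := exists_ne (0 : h.complement)
  obtain ⟨k, hk⟩ := SeparatingDual.exists_ne_zero (R := ℝ) ha
  refine ⟨h.codChart, h.codChart_mem_maximalAtlas, h.mem_codChart_source,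
    k.comp ((ContinuousLinearMap.snd ℝ (EuclideanSpace ℝ (Fin n)) h.complement).comp
      (h.equiv.symm : _ →L[ℝ] _)), fun h0 ↦ hk ?_, O, hO, ?_, fun x hx ↦ ?_⟩
  · have := DFunLike.congr_fun h0 (h.equiv (0, a))
    simpa using this
  · have : (⟨p, hp⟩ : S) ∈ Subtype.val ⁻¹' O := by rw [hOs]; exact h.mem_domChart_source
    exact this
  · have hxs : (⟨x, hx.2⟩ : S) ∈ h.domChart.source := by rw [← hOs]; exact hx.1
    have hxt : h.domChart ⟨x, hx.2⟩ ∈ (h.domChart.extend (𝓡 n)).target := by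
      simpa using h.domChart.map_source hxs
    have := h.writtenInCharts hxt
    simp [h.domChart.left_inv hxs] at this
    simp [this]

theorem mainTheorem8 {n : ℕ} {M : Type*} [TopologicalSpace M]
    [ChartedSpace (EuclideanSpace ℝ (Fin (n + 1))) M] [IsManifold (𝓡 (n + 1)) ∞ M]
    [Bundle.RiemannianBundle (fun x : M ↦ TangentSpace (𝓡 (n + 1)) x)]
    [IsContMDiffRiemannianBundle (𝓡 (n + 1)) ∞ (EuclideanSpace ℝ (Fin (n + 1)))
      (fun x : M ↦ TangentSpace (𝓡 (n + 1)) x)]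
    (S : Set M) (hS : IsHypersurface n S) (c : ℝ) :
    ∀ p ∈ S, ∃ U : Set M, IsOpen U ∧ p ∈ U ∧ ∃ f : M → ℝ,
      ContMDiffOn (𝓡 (n + 1)) 𝓘(ℝ, ℝ) ∞ f U ∧
      (∀ x ∈ U, ‖riemannianGradient (n + 1) f x‖ ^ 2 = 1) ∧
      ∀ x ∈ U ∩ S, f x = c := by
  intro p hp
  obtain ⟨ψ, hψ, hpψ, ℓ, hℓ, O, hO, hpO, hOS⟩ := hS.exists_chart hp
  obtain ⟨U, hUψ, hU, hpU, f, hf, hfe, hfc⟩ := exists_eikonal_of_metric ψ.open_target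
    (contDiffOn_chartMetric hψ)
    (fun y _ v w ↦ by rw [chartMetric_apply, chartMetric_apply, real_inner_comm])
    (fun y hy ↦ chartMetric_pos hψ hy) (ψ.map_source hpψ) ℓ hℓ (hOS p ⟨hpO, hp⟩) c
  -- Intersecting with O discards other parts of S that re-enter the chart domain off the
  -- hyperplane.
  refine ⟨ψ.source ∩ ψ ⁻¹' U ∩ O, (ψ.isOpen_inter_preimage hU).inter hO, ⟨⟨hpψ, hpU⟩, hpO⟩, f ∘ ψ,
    ?_, fun x hx ↦ ?_, fun x hx ↦ hfc _ hx.1.1.2 (hOS x ⟨hx.1.2, hx.2⟩)⟩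
  · exact hf.contMDiffOn.comp ((contMDiffOn_of_mem_maximalAtlas hψ).mono fun x hx ↦ hx.1.1)
      fun x hx ↦ hx.1.2
  · obtain ⟨u, hu, hu1⟩ := hfe _ hx.1.2
    rw [norm_sq_riemannianGradient hψ hx.1.1
      ((hf.contDiffAt (hU.mem_nhds hx.1.2)).differentiableAt (by simp)) hu, hu1]
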